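/- Let $y_1,\dots,y_N$ be independent real random variables with a common distribution function $G$, about which nothing is assumed except that it is continuous. Let $y(1)\le\dots\le y(N)$ be the values $y_1,\dots,y_N$ arranged in increasing order, and put $y(0)=-\infty$, $y(N+1)=+\infty$. Let $r,s$ be integers with $0\le r<s\le N$, let $L=y(r)$, $U=y(s)$, and let $0<\gamma<1$. Then $L$ and $U$ are (Borel measurable, possibly infinite) functions of the sample $(y_1,\dots,y_N)$, and the probability $$\beta=\mathcal P\Big\{\int_L^U dG(y)>\gamma\Big\}$$ satisfies $0<\beta<1$ and $$\beta = 1-I(\gamma,s-r,N-s+r+1)=\sum_{j=0}^{s-r-1}\binom Nj\gamma^j(1-\gamma)^{N-j},$$ where, for integers $j,k\ge1$, $$I(\gamma,j,k)=\int_0^\gamma\frac{u^{j-1}(1-u)^{k-1}}{B(j,k)}\,du,\qquad B(j,k)=\frac{(j-1)!\,(k-1)!}{(j+k-1)!}.$$ Here $\int_L^U dG(y)$ is the mass that the distribution $G$ gives to the interval $[L,U]$, which equals $G(U)-G(L)$ with $G(-\infty)=0$. -/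

import Mathlib

open MeasureTheory ProbabilityTheory

noncomputable section

/-- The `k`-th order statistic `y(k)` of the sample `y = (y₁, …, y_N)`: the `k`-th value after the
sample has been arranged in increasing order, for `1 ≤ k ≤ N`, together with the conventions
`y(0) = -∞` and `y(N+1) = +∞`. -/
def orderStatistic {N : ℕ} (y : Fin N → ℝ) (k : ℕ) : EReal :=
  if k = 0 then ⊥
  else if h : k - 1 < N then (((y ∘ Tuple.sort y) ⟨k - 1, h⟩ : ℝ) : EReal)
  else ⊤

/-- The probability content `∫_L^U dG` of the interval `[L, U]`, with possibly infinite endpoints,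
under the distribution `ν` on the real line (whose distribution function is `G = cdf ν`). -/
def probabilityContent (ν : Measure ℝ) (L U : EReal) : ℝ :=
  ∫ _t in {t : ℝ | L ≤ (t : EReal) ∧ (t : EReal) ≤ U}, (1 : ℝ) ∂ν

/-- `B(j, k) = (j-1)! (k-1)! / (j+k-1)!` for positive integers `j`, `k`. -/
def betaFactorial (j k : ℕ) : ℝ :=
  ((Nat.factorial (j - 1) : ℝ) * (Nat.factorial (k - 1) : ℝ)) / (Nat.factorial (j + k - 1) : ℝ)

/-- The regularized incomplete beta function
`I(γ, j, k) = ∫₀^γ u^(j-1) (1-u)^(k-1) / B(j, k) du` for positive integers `j`, `k`. -/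
def regularizedBeta (γ : ℝ) (j k : ℕ) : ℝ :=
  ∫ u in (0 : ℝ)..γ, u ^ (j - 1) * (1 - u) ^ (k - 1) / betaFactorial j k

end

/-! Since `G` is continuous, the `G(y_i)` are independent and uniform on `[0, 1]` (`hasLaw_cdf`). A
monotone map commutes with sorting, so the content is a gap `u(s) - u(r)` of uniform order
statistics, or `u(s)` itself when `r = 0`. Almost surely there are no ties, and then the gap exceeds
`γ` iff the observation of rank `r` has fewer than `s - r` others within `γ` above it
(`lt_sort_sub_sort_iff`). Fix which observation has that rank, and its value `x`: the others fall
below `x`, in `(x, x + γ]`, or elsewhere, with multinomial probabilities. Integrating over `x` gives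
`1/N` times the binomial weight of the count `b` in the window, whatever the rank
(`pi_restrict_Icc_real_rank_and_card`). Summing over the `N` observations and over `b < s - r` gives
the binomial sum. For `r = 0` it suffices to count the values `≤ γ`. The beta form follows because a
partial binomial sum has a one-term derivative. -/

/-! ### Beta integrals and partial binomial sums. -/

theorem hasDerivAt_sum_choose_mul_pow (N m : ℕ) (hm : m < N) (x : ℝ) :
    HasDerivAt (fun x : ℝ => ∑ j ∈ Finset.range (m + 1), (N.choose j : ℝ) * x ^ j * (1 - x) ^ (N - j))
      (-(((m + 1 : ℕ) * N.choose (m + 1) : ℝ) * (x ^ m * (1 - x) ^ (N - (m + 1))))) x := by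
  have key (j : ℕ) : HasDerivAt (fun x : ℝ => (N.choose j : ℝ) * x ^ j * (1 - x) ^ (N - j))
      ((N.choose j : ℝ) * (j * x ^ (j - 1)) * (1 - x) ^ (N - j)
        + (N.choose j : ℝ) * x ^ j * ((N - j : ℕ) * (1 - x) ^ (N - j - 1) * (-1))) x :=
    ((hasDerivAt_pow j x).const_mul _).mul (((hasDerivAt_id x).const_sub 1).pow (N - j))
  induction m with
  | zero =>
    simpa using key 0
  | succ m ih =>
    simp only [Finset.sum_range_succ _ (m + 1)]
    -- Telescoping: half of the new term's product rule cancels the old derivative, and the other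
    -- half is rewritten by `h'`.
    refine ((ih (by omega)).fun_add (key (m + 1))).congr_deriv ?_
    have h := Nat.choose_succ_right_eq N (m + 1)
    have h' : (N.choose (m + 2) : ℝ) * ((m + 2 : ℕ) : ℝ)
      = N.choose (m + 1) * ((N - (m + 1) : ℕ) : ℝ) := by exact_mod_cast h
    have e : N - (m + 1 + 1) = N - (m + 1) - 1 := by omega
    rw [e, Nat.add_sub_cancel]
    push_cast at h' ⊢
    linear_combination (x ^ (m + 1) * (1 - x) ^ (N - (m + 1) - 1)) * h'

theorem integral_pow_mul_one_sub_pow (a b : ℕ) (γ : ℝ) :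
    ∫ u in (0 : ℝ)..γ, u ^ a * (1 - u) ^ b =
      (1 - ∑ j ∈ Finset.range (a + 1),
        ((a + b + 1).choose j : ℝ) * γ ^ j * (1 - γ) ^ (a + b + 1 - j)) *
        ((a.factorial * b.factorial : ℝ) / (a + b + 1).factorial) := by
  have h := intervalIntegral.integral_eq_sub_of_hasDerivAt (a := 0) (b := γ)
    (fun x _ => hasDerivAt_sum_choose_mul_pow (a + b + 1) a (by omega) x)
    (by apply Continuous.intervalIntegrable; fun_prop)
  have e : a + b + 1 - (a + 1) = b := by omega
  have h0 : ∑ j ∈ Finset.range (a + 1),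
      ((a + b + 1).choose j : ℝ) * (0 : ℝ) ^ j * (1 - 0) ^ (a + b + 1 - j) = 1 := by
    rw [Finset.sum_range_succ']; simp
  have hc : ((a + b + 1).choose (a + 1) : ℝ) * ((a + 1).factorial * b.factorial)
      = (a + b + 1).factorial := by
    have := Nat.choose_mul_factorial_mul_factorial (show a + 1 ≤ a + b + 1 by omega)
    rw [e, mul_assoc] at this
    exact_mod_cast this
  rw [intervalIntegral.integral_neg, intervalIntegral.integral_const_mul, h0, e] at h
  have hf : ((a + b + 1).factorial : ℝ) ≠ 0 := by positivity
  rw [← mul_div_assoc, eq_div_iff hf, ← hc, Nat.factorial_succ]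
  push_cast at h ⊢
  linear_combination (-(a.factorial * b.factorial : ℝ)) * h

theorem integral_zero_one_pow_mul_one_sub_pow (a b : ℕ) :
    ∫ u in (0 : ℝ)..1, u ^ a * (1 - u) ^ b =
      (a.factorial * b.factorial : ℝ) / (a + b + 1).factorial := by
  rw [integral_pow_mul_one_sub_pow, Finset.sum_eq_zero, sub_zero, one_mul]
  intro j hj
  have := Finset.mem_range.1 hj
  rw [sub_self, zero_pow (by omega), mul_zero]

/-- Substitute `u ↦ c * u`; used with `c = 1 - γ`, the range of positions where the window of length
`γ` fits in `[0, 1]`. -/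
theorem integral_pow_mul_sub_pow (a b : ℕ) (c : ℝ) :
    ∫ u in (0 : ℝ)..c, u ^ a * (c - u) ^ b =
      c ^ (a + b + 1) * ((a.factorial * b.factorial : ℝ) / (a + b + 1).factorial) := by
  have h := intervalIntegral.mul_integral_comp_mul_left (a := 0) (b := 1)
    (f := fun u : ℝ => u ^ a * (c - u) ^ b) c
  rw [mul_zero, mul_one] at h
  rw [← h, ← integral_zero_one_pow_mul_one_sub_pow, ← intervalIntegral.integral_const_mul,
    ← intervalIntegral.integral_const_mul]
  congr 1; ext u
  rw [show c - c * u = c * (1 - u) by ring, mul_pow, mul_pow]; ring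

theorem regularizedBeta_eq_one_sub_sum {m N : ℕ} (hm : 0 < m) (hmN : m ≤ N) (γ : ℝ) :
    regularizedBeta γ m (N - m + 1) =
      1 - ∑ j ∈ Finset.range m, (N.choose j : ℝ) * γ ^ j * (1 - γ) ^ (N - j) := by
  obtain ⟨a, rfl⟩ : ∃ a, m = a + 1 := ⟨m - 1, by omega⟩
  obtain ⟨b, rfl⟩ : ∃ b, N = a + b + 1 := ⟨N - a - 1, by omega⟩
  have e : a + b + 1 - (a + 1) = b := by omega
  have e' : a + 1 + (b + 1) - 1 = a + b + 1 := by omega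
  simp only [regularizedBeta, betaFactorial, e, e', Nat.add_sub_cancel]
  rw [intervalIntegral.integral_div, integral_pow_mul_one_sub_pow, mul_div_cancel_right₀]
  positivity

theorem sum_choose_mul_pow_pos {m N : ℕ} (hm : 0 < m) {γ : ℝ} (h0 : 0 < γ) (h1 : γ < 1) :
    0 < ∑ j ∈ Finset.range m, (N.choose j : ℝ) * γ ^ j * (1 - γ) ^ (N - j) := by
  have h : 0 < 1 - γ := sub_pos.2 h1
  refine Finset.sum_pos' (fun j _ => by positivity) ⟨0, Finset.mem_range.2 hm, ?_⟩
  simp only [Nat.choose_zero_right]; positivity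

theorem sum_choose_mul_pow_lt_one {m N : ℕ} (hmN : m ≤ N) {γ : ℝ} (h0 : 0 < γ) (h1 : γ < 1) :
    ∑ j ∈ Finset.range m, (N.choose j : ℝ) * γ ^ j * (1 - γ) ^ (N - j) < 1 := by
  have h : 0 < 1 - γ := sub_pos.2 h1
  have hs : ∑ j ∈ Finset.range (N + 1), (N.choose j : ℝ) * γ ^ j * (1 - γ) ^ (N - j) = 1 := by
    have := add_pow γ (1 - γ) N
    rw [add_sub_cancel, one_pow] at this
    exact (Finset.sum_congr rfl fun j _ => by ring).trans this.symm
  refine lt_of_lt_of_eq ?_ hs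
  have hsub : Finset.range m ⊆ Finset.range (N + 1) := Finset.range_subset_range.2 (by omega)
  refine Finset.sum_lt_sum_of_subset (i := N) hsub (Finset.self_mem_range_succ N)
    (by simpa using hmN) ?_ (fun j _ _ => by positivity)
  rw [Nat.choose_self]; positivity

/-! ### Multinomial counts under a product measure. -/

/-- Multinomial probabilities for three cells `A`, `B` and the complement of their union. -/
theorem pi_real_card_eq_and_card_eq {α : Type*} [MeasurableSpace α] (μ : Measure α)
    [IsProbabilityMeasure μ] {A B : Set α} [DecidablePred (· ∈ A)] [DecidablePred (· ∈ B)]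
    (hA : MeasurableSet A) (hB : MeasurableSet B) (hAB : Disjoint A B) (n a b : ℕ) :
    (Measure.pi fun _ : Fin n => μ).real
      {w | (Finset.univ.filter fun j => w j ∈ A).card = a ∧
        (Finset.univ.filter fun j => w j ∈ B).card = b} =
      (n.choose a : ℝ) * ((n - a).choose b : ℝ) * μ.real A ^ a * μ.real B ^ b *
        (1 - μ.real A - μ.real B) ^ (n - a - b) := by
  classical
  -- The event is a disjoint union of boxes, one for each choice of the indices `S` landing in `A`
  -- and `T` landing in `B`.
  let I : Finset ((_ : Finset (Fin n)) × Finset (Fin n)) :=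
    (Finset.powersetCard a Finset.univ).sigma fun S => Finset.powersetCard b Sᶜ
  let cell (p : (_ : Finset (Fin n)) × Finset (Fin n)) (j : Fin n) : Set α :=
    if j ∈ p.1 then A else if j ∈ p.2 then B else (A ∪ B)ᶜ
  have hcell (p) (j) : MeasurableSet (cell p j) := by
    simp only [cell]; split_ifs
    exacts [hA, hB, (hA.union hB).compl]
  have hmem (w : Fin n → α) (p) (hp : p ∈ I) : w ∈ Set.univ.pi (cell p) ↔
      p = ⟨Finset.univ.filter fun j => w j ∈ A, Finset.univ.filter fun j => w j ∈ B⟩ := by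
    obtain ⟨S, T⟩ := p
    simp only [I, Finset.mem_sigma, Finset.mem_powersetCard] at hp
    have hd : ∀ j ∈ T, j ∉ S := fun j hj => by simpa using hp.2.1 hj
    simp only [Set.mem_univ_pi, cell]
    constructor
    · intro h
      have hS : S = Finset.univ.filter fun j => w j ∈ A := by
        ext j
        have hj := h j
        by_cases h1 : j ∈ S
        · simpa [h1] using hj
        · by_cases h2 : j ∈ T
          · simpa [h1, h2] using Set.disjoint_right.1 hAB (by simpa [h1, h2] using hj)
          · simp only [h1, h2, if_false, Set.mem_compl_iff, Set.mem_union, not_or] at hj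
            simpa [h1] using hj.1
      have hT : T = Finset.univ.filter fun j => w j ∈ B := by
        ext j
        have hj := h j
        by_cases h2 : j ∈ T
        · simpa [hd j h2, h2] using hj
        · by_cases h1 : j ∈ S
          · simpa [h1, h2] using Set.disjoint_left.1 hAB (by simpa [h1] using hj)
          · simp only [h1, h2, if_false, Set.mem_compl_iff, Set.mem_union, not_or] at hj
            simpa [h2] using hj.2
      rw [← hS, ← hT]
    · intro h j
      simp only [Sigma.mk.injEq, heq_eq_eq] at h
      rw [h.1, h.2]
      by_cases h1 : w j ∈ A <;> by_cases h2 : w j ∈ B <;> simp [h1, h2]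
  have hset : {w : Fin n → α | (Finset.univ.filter fun j => w j ∈ A).card = a ∧
        (Finset.univ.filter fun j => w j ∈ B).card = b} = ⋃ p ∈ I, Set.univ.pi (cell p) := by
    ext w
    simp only [Set.mem_ofPred_eq, Set.mem_iUnion]
    constructor
    · rintro ⟨h1, h2⟩
      have hI : (⟨Finset.univ.filter fun j => w j ∈ A, Finset.univ.filter fun j => w j ∈ B⟩ :
          (_ : Finset (Fin n)) × Finset (Fin n)) ∈ I := by
        simp only [I, Finset.mem_sigma, Finset.mem_powersetCard, Finset.subset_univ, true_and]
        refine ⟨h1, fun j hj => ?_, h2⟩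
        simp only [Finset.mem_filter, Finset.mem_univ, true_and, Finset.mem_compl] at hj ⊢
        exact Set.disjoint_right.1 hAB hj
      exact ⟨_, hI, (hmem w _ hI).2 rfl⟩
    · rintro ⟨p, hp, hw⟩
      have := (hmem w p hp).1 hw
      subst this
      simp only [I, Finset.mem_sigma, Finset.mem_powersetCard] at hp
      exact ⟨hp.1.2, hp.2.2⟩
  have hbox (p) (hp : p ∈ I) : (Measure.pi fun _ : Fin n => μ).real (Set.univ.pi (cell p)) =
      μ.real A ^ a * μ.real B ^ b * (1 - μ.real A - μ.real B) ^ (n - a - b) := by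
    obtain ⟨S, T⟩ := p
    simp only [I, Finset.mem_sigma, Finset.mem_powersetCard] at hp
    have hc : μ.real (A ∪ B)ᶜ = 1 - μ.real A - μ.real B := by
      rw [probReal_compl_eq_one_sub (hA.union hB), measureReal_union hAB hB]; ring
    have hite (j : Fin n) : μ.real (cell ⟨S, T⟩ j) = if j ∈ S then μ.real A else
        if j ∈ T then μ.real B else 1 - μ.real A - μ.real B := by
      simp only [cell]; split_ifs
      exacts [rfl, rfl, hc]
    have e1 : (Finset.univ.filter fun j => j ∉ S) = Sᶜ := by ext; simp
    have e2 : (Sᶜ.filter fun j => j ∈ T) = T := by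
      ext j; simp only [Finset.mem_filter]; exact ⟨fun h => h.2, fun h => ⟨hp.2.1 h, h⟩⟩
    have e3 : (Sᶜ.filter fun j => j ∉ T) = Sᶜ \ T := by ext; simp
    rw [measureReal_def, Measure.pi_pi, ENNReal.toReal_prod]
    simp only [← measureReal_def, hite]
    rw [Finset.prod_ite, Finset.prod_ite, e1, e2, e3]
    simp only [Finset.prod_const, Finset.filter_mem_eq_inter, Finset.univ_inter, hp.1.2, hp.2.2,
      Finset.card_sdiff_of_subset hp.2.1, Finset.card_compl, Fintype.card_fin, mul_assoc]
  rw [hset, measureReal_biUnion_finset]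
  · rw [Finset.sum_congr rfl hbox, Finset.sum_const]
    have hcard : I.card = n.choose a * (n - a).choose b := by
      rw [Finset.card_sigma, Finset.sum_congr rfl (g := fun _ => (n - a).choose b)]
      · simp
      · intro S hS
        rw [Finset.card_powersetCard, Finset.card_compl, (Finset.mem_powersetCard.1 hS).2,
          Fintype.card_fin]
    rw [hcard, nsmul_eq_mul]; push_cast; ring
  · intro p hp q hq hpq
    refine Set.disjoint_left.2 fun w hw hw' => hpq ?_
    rw [(hmem w p hp).1 hw, (hmem w q hq).1 hw']
  · exact fun p _ => MeasurableSet.univ_pi (hcell p)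

/-! ### Order statistics through counting, and their measurability. -/

theorem card_filter_comp_perm {ι : Type*} [Fintype ι] (σ : Equiv.Perm ι)
    (p : ι → Prop) [DecidablePred p] :
    (Finset.univ.filter fun j => p (σ j)).card = (Finset.univ.filter p).card := by
  rw [← Fintype.card_subtype, ← Fintype.card_subtype]
  exact Fintype.card_congr (σ.subtypeEquiv fun _ => Iff.rfl)

/-- In a sample with distinct values, the gap between two order statistics exceeds `γ` if and only
if some observation has the lower rank and few observations lie within `γ` above it. -/
theorem lt_sort_sub_sort_iff {N : ℕ} {v : Fin N → ℝ} (hv : Function.Injective v)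
    (k l : Fin N) (hkl : k < l) (γ : ℝ) :
    γ < v (Tuple.sort v l) - v (Tuple.sort v k) ↔
      ∃ i, (Finset.univ.filter fun j => v j < v i).card = (k : ℕ) ∧
        (Finset.univ.filter fun j => v i < v j ∧ v j ≤ v i + γ).card < (l : ℕ) - k := by
  set σ := Tuple.sort v
  have hw : StrictMono (v ∘ σ) :=
    (Tuple.monotone_sort v).strictMono_of_injective (hv.comp σ.injective)
  have hrank (m : Fin N) : (Finset.univ.filter fun j => v j < v (σ m)).card = (m : ℕ) := by
    rw [← card_filter_comp_perm σ]
    have : (Finset.univ.filter fun j => v (σ j) < v (σ m)) = Finset.Iio m := by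
      ext j; simpa using hw.lt_iff_lt
    rw [this, Fin.card_Iio]
  constructor
  · intro h
    refine ⟨σ k, hrank k, ?_⟩
    rw [← card_filter_comp_perm σ]
    -- A value in the window lies strictly between the two order statistics, so its rank lies in
    -- `Ioo k l`.
    refine (Finset.card_le_card (t := Finset.Ioo k l) fun j hj => ?_).trans_lt ?_
    · simp only [Finset.mem_filter, Finset.mem_univ, true_and] at hj
      refine Finset.mem_Ioo.2 ⟨hw.lt_iff_lt.1 hj.1, hw.lt_iff_lt.1 ?_⟩
      simp only [Function.comp]; linarith [hj.2]
    · rw [Fin.card_Ioo]; have : (k : ℕ) < l := hkl; omega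
  · rintro ⟨i, h1, h2⟩
    obtain ⟨m, rfl⟩ := σ.surjective i
    rw [hrank] at h1
    obtain rfl : m = k := Fin.ext h1
    by_contra! h
    -- If the gap is at most `γ`, all `l - k` ranks in `Ioc k l` fall in the window.
    refine absurd h2 (not_lt.2 ?_)
    rw [← card_filter_comp_perm σ, ← Fin.card_Ioc]
    refine Finset.card_le_card fun j hj => ?_
    have hj := Finset.mem_Ioc.1 hj
    simp only [Finset.mem_filter, Finset.mem_univ, true_and]
    have h3 : v (σ j) ≤ v (σ l) := hw.monotone hj.2
    exact ⟨hw hj.1, by linarith⟩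

theorem lt_sort_iff {N : ℕ} (v : Fin N → ℝ) (l : Fin N) (γ : ℝ) :
    γ < v (Tuple.sort v l) ↔ (Finset.univ.filter fun j => v j ≤ γ).card ≤ (l : ℕ) := by
  rw [← not_le, ← not_lt (a := (l : ℕ)), ← card_filter_comp_perm (Tuple.sort v)]
  exact not_congr (Tuple.lt_card_le_iff_apply_le_of_monotone (Tuple.monotone_sort v)).symm

theorem measurableSet_card_filter {α : Type*} [MeasurableSpace α] {ι : Type*} [Fintype ι]
    (p : α → ι → Prop) [∀ x, DecidablePred (p x)] (hp : ∀ j, MeasurableSet {x | p x j})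
    (S : Set ℕ) : MeasurableSet {x | (Finset.univ.filter (p x)).card ∈ S} := by
  have h : Measurable fun x => (Finset.univ.filter (p x)).card := by
    simp only [Finset.card_filter]
    exact Finset.measurable_sum _ fun j _ => Measurable.ite (hp j) measurable_const measurable_const
  exact h (MeasurableSet.of_discrete)

/-- The sorting permutation is avoided: each superlevel set is a condition on the number of values
`≤ t`. -/
theorem measurable_apply_sort {N : ℕ} (l : Fin N) :
    Measurable fun v : Fin N → ℝ => v (Tuple.sort v l) := by
  refine measurable_of_Ioi fun t => ?_
  have : (fun v : Fin N → ℝ => v (Tuple.sort v l)) ⁻¹' Set.Ioi t =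
      {v | (Finset.univ.filter fun j => v j ≤ t).card ∈ Set.Iic (l : ℕ)} := by
    ext v; exact lt_sort_iff v l t
  rw [this]
  exact measurableSet_card_filter _
    (fun j => measurableSet_le (measurable_pi_apply j) measurable_const) _

theorem measurable_orderStatistic {N : ℕ} (k : ℕ) :
    Measurable fun v : Fin N → ℝ => orderStatistic v k := by
  unfold orderStatistic
  split_ifs with h0 h
  exacts [measurable_const, (measurable_apply_sort _).coe_real_ereal, measurable_const]

/-! ### Gaps of uniform order statistics. -/

instance isProbabilityMeasure_restrict_Icc_zero_one :
    IsProbabilityMeasure (volume.restrict (Set.Icc (0 : ℝ) 1)) := ⟨by simp⟩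

theorem measureReal_prod_eq_integral {α β : Type*} [MeasurableSpace α] [MeasurableSpace β]
    (μ : Measure α) (π : Measure β) [IsFiniteMeasure μ] [IsFiniteMeasure π]
    {F : Set (α × β)} (hF : MeasurableSet F) :
    (μ.prod π).real F = ∫ x, π.real (Prod.mk x ⁻¹' F) ∂μ := by
  simp only [measureReal_def]
  rw [Measure.prod_apply hF, integral_toReal (measurable_measure_prodMk_left hF).aemeasurable
    (ae_of_all _ fun x => measure_lt_top _ _)]

theorem measurableSet_lt_and_le {α : Type*} [MeasurableSpace α] {f g h : α → ℝ}
    (hf : Measurable f) (hg : Measurable g) (hh : Measurable h) :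
    MeasurableSet {x | f x < g x ∧ g x ≤ h x} :=
  (measurableSet_lt hf hg).inter (measurableSet_le hg hh)

theorem card_filter_succAbove {n : ℕ} (i : Fin (n + 1)) (p : Fin (n + 1) → Prop)
    [DecidablePred p] (hi : ¬ p i) :
    (Finset.univ.filter p).card = (Finset.univ.filter fun j => p (i.succAbove j)).card := by
  simp only [Finset.card_filter]
  rw [Fin.sum_univ_succAbove _ i, if_neg hi, zero_add]

theorem restrict_Icc_real_Iio {x : ℝ} (h1 : x ≤ 1) (h0 : 0 ≤ x) :
    (volume.restrict (Set.Icc (0 : ℝ) 1)).real (Set.Iio x) = x := by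
  have : Set.Iio x ∩ Set.Icc (0 : ℝ) 1 = Set.Ico 0 x := by
    ext t; simp only [Set.mem_inter_iff, Set.mem_Iio, Set.mem_Icc, Set.mem_Ico]
    exact ⟨fun h => ⟨h.2.1, h.1⟩, fun h => ⟨h.2, h.1, by linarith [h.2]⟩⟩
  rw [measureReal_restrict_apply measurableSet_Iio, this, Real.volume_real_Ico_of_le h0, sub_zero]

theorem restrict_Icc_real_Iic {x : ℝ} (h1 : x ≤ 1) (h0 : 0 ≤ x) :
    (volume.restrict (Set.Icc (0 : ℝ) 1)).real (Set.Iic x) = x := by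
  rw [measureReal_congr Iio_ae_eq_Iic.symm, restrict_Icc_real_Iio h1 h0]

theorem restrict_Icc_real_Ioc {x y : ℝ} (h0 : 0 ≤ x) (hx1 : x ≤ 1) (hxy : x ≤ y) :
    (volume.restrict (Set.Icc (0 : ℝ) 1)).real (Set.Ioc x y) = min y 1 - x := by
  have : Set.Ioc x y ∩ Set.Icc (0 : ℝ) 1 = Set.Ioc x (min y 1) := by
    ext t; simp only [Set.mem_inter_iff, Set.mem_Icc, Set.mem_Ioc, le_min_iff]
    exact ⟨fun h => ⟨h.1.1, h.1.2, h.2.2⟩, fun h => ⟨⟨h.1, h.2.1⟩, by linarith [h.1], h.2.2⟩⟩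
  rw [measureReal_restrict_apply measurableSet_Ioc, this,
    Real.volume_real_Ioc_of_le (le_min hxy hx1)]

/-- Condition on `v i = x`: the other `a + b + c` points have cells of mass `x`, `γ`, `1 - γ - x`,
and a beta integral over `x` remains. Its factorials cancel the dependence on `a`, apart from the
sample size. -/
theorem pi_restrict_Icc_real_rank_and_card {a b c : ℕ} (hc : 0 < c)
    {γ : ℝ} (hγ0 : 0 < γ) (hγ1 : γ < 1) (i : Fin (a + b + c + 1)) :
    (Measure.pi fun _ : Fin (a + b + c + 1) => volume.restrict (Set.Icc (0 : ℝ) 1)).real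
      {v | (Finset.univ.filter fun j => v j < v i).card = a ∧
        (Finset.univ.filter fun j => v i < v j ∧ v j ≤ v i + γ).card = b} =
      ((a + b + c + 1).choose b : ℝ) * γ ^ b * (1 - γ) ^ (a + b + c + 1 - b)
        / (a + b + c + 1 : ℕ) := by
  set μ := volume.restrict (Set.Icc (0 : ℝ) 1)
  let F : Set (ℝ × (Fin (a + b + c) → ℝ)) :=
    {p | (Finset.univ.filter fun j => p.2 j < p.1).card = a ∧
      (Finset.univ.filter fun j => p.1 < p.2 j ∧ p.2 j ≤ p.1 + γ).card = b}
  have hF : MeasurableSet F :=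
    (measurableSet_card_filter (fun (p : ℝ × (Fin (a + b + c) → ℝ)) j => p.2 j < p.1)
      (fun j => measurableSet_lt (by fun_prop) (by fun_prop)) {a}).inter
    (measurableSet_card_filter
      (fun (p : ℝ × (Fin (a + b + c) → ℝ)) j => p.1 < p.2 j ∧ p.2 j ≤ p.1 + γ)
      (fun j => measurableSet_lt_and_le (by fun_prop) (by fun_prop) (by fun_prop)) {b})
  have hpre : {v : Fin (a + b + c + 1) → ℝ | (Finset.univ.filter fun j => v j < v i).card = a ∧
        (Finset.univ.filter fun j => v i < v j ∧ v j ≤ v i + γ).card = b} =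
      MeasurableEquiv.piFinSuccAbove (fun _ => ℝ) i ⁻¹' F := by
    ext v
    simp only [Set.mem_ofPred_eq, Set.mem_preimage, F]
    rw [card_filter_succAbove i (fun j => v j < v i) (lt_irrefl _),
      card_filter_succAbove i (fun j => v i < v j ∧ v j ≤ v i + γ) (fun h => lt_irrefl _ h.1)]
    rfl
  have hsection (x : ℝ) (hx : x ∈ Set.Icc (0 : ℝ) 1) :
      (Measure.pi fun _ : Fin (a + b + c) => μ).real (Prod.mk x ⁻¹' F) =
        (Set.Iic (1 - γ)).indicator (fun x => ((a + b + c).choose a : ℝ) * ((b + c).choose b : ℝ) *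
          γ ^ b * (x ^ a * (1 - γ - x) ^ c)) x := by
    have e1 : a + b + c - a = b + c := by omega
    have e2 : b + c - b = c := by omega
    have hdisj : Disjoint (Set.Iio x) (Set.Ioc x (x + γ)) :=
      Set.disjoint_left.2 fun t ht ht' => lt_asymm ht ht'.1
    have h := pi_real_card_eq_and_card_eq μ measurableSet_Iio measurableSet_Ioc hdisj
      (a + b + c) a b
    rw [restrict_Icc_real_Iio hx.2 hx.1, restrict_Icc_real_Ioc hx.1 hx.2 (by linarith), e1, e2] at h
    refine h.trans ?_
    by_cases hxγ : x ≤ 1 - γ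
    · rw [Set.indicator_of_mem (by exact hxγ), min_eq_left (by linarith)]; ring
    -- The window now covers everything above `x`, so the third cell is null; as `c > 0` points must
    -- fall there, the probability vanishes.
    · rw [Set.indicator_of_notMem (by exact hxγ), min_eq_right (by linarith),
        sub_self, zero_pow hc.ne', mul_zero]
  have hint : ∫ x, (Measure.pi fun _ : Fin (a + b + c) => μ).real (Prod.mk x ⁻¹' F) ∂μ =
      ∫ x in (0 : ℝ)..(1 - γ), ((a + b + c).choose a : ℝ) * ((b + c).choose b : ℝ) *
          γ ^ b * (x ^ a * (1 - γ - x) ^ c) := by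
    rw [setIntegral_congr_fun measurableSet_Icc hsection, setIntegral_indicator measurableSet_Iic,
      intervalIntegral.integral_of_le (by linarith), ← integral_Icc_eq_integral_Ioc]
    congr 2
    rw [← Set.Ici_inter_Iic, Set.inter_assoc, Set.Iic_inter_Iic, Set.Ici_inter_Iic,
      min_eq_right (by linarith)]
  have hmp := measurePreserving_piFinSuccAbove (fun _ : Fin (a + b + c + 1) => μ) i
  rw [hpre, measureReal_def, hmp.measure_preimage hF.nullMeasurableSet, ← measureReal_def,
    measureReal_prod_eq_integral _ _ hF, hint, intervalIntegral.integral_const_mul,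
    integral_pow_mul_sub_pow]
  have c1 : ((a + b + c).choose a : ℝ) * (a.factorial * (b + c).factorial)
      = (a + b + c).factorial := by
    have := Nat.choose_mul_factorial_mul_factorial (show a ≤ a + b + c by omega)
    rw [show a + b + c - a = b + c by omega, mul_assoc] at this
    exact_mod_cast this
  have c2 : ((b + c).choose b : ℝ) * (b.factorial * c.factorial) = (b + c).factorial := by
    have := Nat.choose_mul_factorial_mul_factorial (show b ≤ b + c by omega)
    rw [show b + c - b = c by omega, mul_assoc] at this
    exact_mod_cast this
  have e3 : a + b + c + 1 - b = a + c + 1 := by omega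
  have c3 : ((a + b + c + 1).choose b : ℝ) * (b.factorial * (a + c + 1).factorial)
      = (a + b + c + 1 : ℕ) * (a + b + c).factorial := by
    have := Nat.choose_mul_factorial_mul_factorial (show b ≤ a + b + c + 1 by omega)
    rw [e3, mul_assoc, Nat.factorial_succ (a + b + c)] at this
    exact_mod_cast this
  have hb : (b.factorial : ℝ) ≠ 0 := by positivity
  have hac : ((a + c + 1).factorial : ℝ) ≠ 0 := by positivity
  have hN : ((a + b + c + 1 : ℕ) : ℝ) ≠ 0 := by positivity
  have key : ((a + b + c).choose a : ℝ) * ((b + c).choose b : ℝ) *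
      (a.factorial * c.factorial / (a + c + 1).factorial) =
      (a + b + c + 1).choose b / (a + b + c + 1 : ℕ) := by
    rw [← mul_div_assoc, div_eq_div_iff hac hN]
    apply mul_left_cancel₀ hb
    linear_combination (a + b + c + 1 : ℕ) * (((a + b + c).choose a : ℝ) * a.factorial * c2 + c1)
      - c3
  rw [e3]
  linear_combination γ ^ b * (1 - γ) ^ (a + c + 1) * key

/-- Each coincidence `v i = v j` with `i ≠ j` confines `v` to a proper subspace, which is Lebesgue
null. -/
theorem ae_injective_pi_restrict {N : ℕ} (s : Set ℝ) :
    ∀ᵐ v ∂(Measure.pi fun _ : Fin N => (volume : Measure ℝ).restrict s), Function.Injective v := by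
  rw [← Measure.restrict_pi_pi]
  refine ae_restrict_of_ae ?_
  have h (i j : Fin N) (hij : i ≠ j) :
      ∀ᵐ v ∂(Measure.pi fun _ : Fin N => (volume : Measure ℝ)), v i ≠ v j := by
    let S : Submodule ℝ (Fin N → ℝ) :=
      LinearMap.ker ((LinearMap.proj i : (Fin N → ℝ) →ₗ[ℝ] ℝ) - LinearMap.proj j)
    have hS : S ≠ ⊤ := fun h => by
      have : (Pi.single i (1 : ℝ) : Fin N → ℝ) ∈ S := h ▸ Submodule.mem_top
      simp [S, LinearMap.mem_ker, hij.symm] at this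
    have h0 := Measure.addHaar_submodule (volume : Measure (Fin N → ℝ)) S hS
    refine (measure_eq_zero_iff_ae_notMem.1 h0).mono fun v hv h => hv ?_
    simp [S, LinearMap.mem_ker, h]
  have h' : ∀ᵐ v ∂(Measure.pi fun _ : Fin N => (volume : Measure ℝ)), ∀ i j, i ≠ j → v i ≠ v j :=
    ae_all_iff.2 fun i => ae_all_iff.2 fun j => by
      by_cases hij : i = j
      · exact ae_of_all _ fun v h => absurd hij h
      · exact (h i j hij).mono fun v hv _ => hv
  exact h'.mono fun v hv i j hij => by_contra fun hne => hv i j hne hij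

theorem eq_of_card_filter_lt_eq {N : ℕ} {v : Fin N → ℝ} (hv : Function.Injective v) {i j : Fin N}
    (h : (Finset.univ.filter fun k => v k < v i).card =
      (Finset.univ.filter fun k => v k < v j).card) : i = j := by
  have aux {i j : Fin N} (hij : v i < v j) : (Finset.univ.filter fun k => v k < v i).card <
      (Finset.univ.filter fun k => v k < v j).card := by
    refine Finset.card_lt_card (Finset.ssubset_iff_of_subset ?_ |>.2 ⟨i, by simpa using hij, by simp⟩)
    intro k hk
    simp only [Finset.mem_filter, Finset.mem_univ, true_and] at hk ⊢
    exact hk.trans hij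
  rcases lt_trichotomy (v i) (v j) with hij | hij | hij
  exacts [absurd h (aux hij).ne, hv hij, absurd h (aux hij).ne']

theorem pi_restrict_Icc_real_lt_sort_sub_sort {N : ℕ} (k l : Fin N) (hkl : k < l)
    {γ : ℝ} (hγ0 : 0 < γ) (hγ1 : γ < 1) :
    (Measure.pi fun _ : Fin N => volume.restrict (Set.Icc (0 : ℝ) 1)).real
      {v | γ < v (Tuple.sort v l) - v (Tuple.sort v k)} =
    ∑ j ∈ Finset.range (l - k), (N.choose j : ℝ) * γ ^ j * (1 - γ) ^ (N - j) := by
  set π := Measure.pi fun _ : Fin N => volume.restrict (Set.Icc (0 : ℝ) 1)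
  let E (p : Fin N × ℕ) : Set (Fin N → ℝ) :=
    {v | (Finset.univ.filter fun j => v j < v p.1).card = (k : ℕ) ∧
        (Finset.univ.filter fun j => v p.1 < v j ∧ v j ≤ v p.1 + γ).card = p.2}
  have hE (p) : MeasurableSet (E p) :=
    (measurableSet_card_filter (fun (v : Fin N → ℝ) j => v j < v p.1)
      (fun j => measurableSet_lt (by fun_prop) (by fun_prop)) {(k : ℕ)}).inter
    (measurableSet_card_filter
      (fun (v : Fin N → ℝ) j => v p.1 < v j ∧ v j ≤ v p.1 + γ)
      (fun j => measurableSet_lt_and_le (by fun_prop) (by fun_prop) (by fun_prop)) {p.2})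
  have hinj : ∀ᵐ v ∂π, Function.Injective v := ae_injective_pi_restrict _
  let I : Finset (Fin N × ℕ) := Finset.univ ×ˢ Finset.range (l - k)
  have hunion : {v : Fin N → ℝ | γ < v (Tuple.sort v l) - v (Tuple.sort v k)} =ᵐ[π]
      ⋃ p ∈ I, E p := by
    rw [Filter.eventuallyEq_set]
    refine hinj.mono fun v hv => (lt_sort_sub_sort_iff hv k l hkl γ).trans ?_
    simp only [Set.mem_iUnion, Prod.exists, I, Finset.mem_product, Finset.mem_univ, true_and,
      Finset.mem_range, E, Set.mem_ofPred_eq]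
    exact ⟨fun ⟨i, h1, h2⟩ => ⟨i, _, h2, h1, rfl⟩, fun ⟨i, b, hb, h1, h2⟩ => ⟨i, h1, h2 ▸ hb⟩⟩
  have hdisj : (I : Set (Fin N × ℕ)).Pairwise (Function.onFun (AEDisjoint π) E) := by
    intro p _ q _ hpq
    refine measure_mono_null (t := {v | ¬ Function.Injective v}) (fun v hv hv' => ?_)
      (ae_iff.1 hinj)
    have h1 : p.1 = q.1 := eq_of_card_filter_lt_eq hv' (hv.1.1.trans hv.2.1.symm)
    refine hpq (Prod.ext h1 ?_)
    rw [← hv.1.2, ← hv.2.2, h1]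
  have hterm (p) (hp : p ∈ I) : π.real (E p) =
      (N.choose p.2 : ℝ) * γ ^ p.2 * (1 - γ) ^ (N - p.2) / N := by
    obtain ⟨i, b⟩ := p
    have hb : b < l - k := by simpa [I] using hp
    -- At least one point lies above the window, since `k + b < l < N`; this supplies the positive
    -- third count.
    obtain ⟨c, hc⟩ : ∃ c, N = k + b + (c + 1) + 1 := ⟨N - k - b - 2, by omega⟩
    have := fun i => pi_restrict_Icc_real_rank_and_card (a := k) (b := b) c.succ_pos hγ0 hγ1 i
    simp only [Nat.succ_eq_add_one] at this
    rw [← hc] at this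
    exact this i
  have hN : (N : ℝ) ≠ 0 := by have := k.pos; positivity
  rw [measureReal_congr hunion, measureReal_biUnion_finset₀ hdisj (fun p _ => (hE p).nullMeasurableSet),
    Finset.sum_congr rfl hterm, Finset.sum_product_right]
  refine Finset.sum_congr rfl fun j _ => ?_
  dsimp only
  -- The `N` choices of the observation of rank `k` cancel the factor `1/N`.
  rw [Finset.sum_const, Finset.card_univ, Fintype.card_fin, nsmul_eq_mul, mul_div_cancel₀ _ hN]

theorem pi_restrict_Icc_real_lt_sort {N : ℕ} (l : Fin N) {γ : ℝ} (hγ0 : 0 < γ) (hγ1 : γ < 1) :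
    (Measure.pi fun _ : Fin N => volume.restrict (Set.Icc (0 : ℝ) 1)).real
      {v | γ < v (Tuple.sort v l)} =
    ∑ j ∈ Finset.range (l + 1), (N.choose j : ℝ) * γ ^ j * (1 - γ) ^ (N - j) := by
  classical
  let E (b : ℕ) : Set (Fin N → ℝ) := {v | (Finset.univ.filter fun j => v j ≤ γ).card = b}
  have hE (b) : MeasurableSet (E b) :=
    measurableSet_card_filter (fun (v : Fin N → ℝ) j => v j ≤ γ)
      (fun j => measurableSet_le (by fun_prop) (by fun_prop)) {b}
  have hunion : {v : Fin N → ℝ | γ < v (Tuple.sort v l)} =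
      ⋃ b ∈ Finset.range (l + 1), E b := by
    ext v
    refine (lt_sort_iff v l γ).trans ?_
    simp [E]
  rw [hunion, measureReal_biUnion_finset _ (fun b _ => hE b)]
  · refine Finset.sum_congr rfl fun b _ => ?_
    -- The binomial law is the multinomial one with an empty first cell.
    have h := pi_real_card_eq_and_card_eq (volume.restrict (Set.Icc (0 : ℝ) 1))
      MeasurableSet.empty measurableSet_Iic (Set.empty_disjoint (Set.Iic γ)) N 0 b
    simpa [restrict_Icc_real_Iic hγ1.le hγ0.le] using h
  · intro b _ c _ hbc
    exact Set.disjoint_left.2 fun v hv hv' => hbc (hv.symm.trans hv')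

/-! ### Probability integral transform and reduction to the uniform case. -/

/-- When nonempty, the set is a half-line ending at its supremum `t₀`, finite because `u < 1`, and
the intermediate value theorem forces `cdf ν t₀ = u`. It can be empty only for `u = 0`. -/
theorem measure_cdf_le {ν : Measure ℝ} [IsProbabilityMeasure ν] (hcont : Continuous (cdf ν))
    {u : ℝ} (h0 : 0 ≤ u) (h1 : u < 1) : ν {t | cdf ν t ≤ u} = ENNReal.ofReal u := by
  obtain ⟨t₁, ht₁⟩ := ((tendsto_cdf_atTop ν).eventually_const_lt h1).exists
  rcases Set.eq_empty_or_nonempty {t | cdf ν t ≤ u} with he | hne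
  · rcases h0.eq_or_lt with rfl | h0
    · simp [he]
    · obtain ⟨t, ht⟩ := ((tendsto_cdf_atBot ν).eventually_lt_const h0).exists
      exact absurd (show t ∈ {t | cdf ν t ≤ u} from ht.le) (by simp [he])
  · have hb : BddAbove {t | cdf ν t ≤ u} := ⟨t₁, fun t ht => by
      by_contra! h
      exact absurd (monotone_cdf ν h.le) (not_le.2 (lt_of_le_of_lt ht ht₁))⟩
    have hmem := (isClosed_le hcont continuous_const).csSup_mem hne hb
    set t₀ := sSup {t | cdf ν t ≤ u}
    have hmem' : cdf ν t₀ ≤ u := hmem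
    have hle : t₀ ≤ t₁ := by
      by_contra! h
      exact absurd (monotone_cdf ν h.le) (not_le.2 (lt_of_le_of_lt hmem' ht₁))
    obtain ⟨t, ht, htu⟩ := intermediate_value_Icc hle hcont.continuousOn ⟨hmem', ht₁.le⟩
    have htt : t = t₀ := le_antisymm (le_csSup hb htu.le) ht.1
    have hset : {t | cdf ν t ≤ u} = Set.Iic t₀ := by
      ext x
      exact ⟨fun hx => le_csSup hb hx, fun hx => (monotone_cdf ν hx).trans hmem'⟩
    rw [hset, ← ofReal_cdf, ← htt, htu]

/-- The probability integral transform. -/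
theorem hasLaw_cdf {ν : Measure ℝ} [IsProbabilityMeasure ν] (hcont : Continuous (cdf ν)) :
    HasLaw (cdf ν) (volume.restrict (Set.Icc (0 : ℝ) 1)) ν where
  aemeasurable := hcont.measurable.aemeasurable
  map_eq := by
    have := Measure.isProbabilityMeasure_map (μ := ν) hcont.measurable.aemeasurable
    refine Measure.ext_of_Iic _ _ fun u => ?_
    rw [Measure.map_apply hcont.measurable measurableSet_Iic,
      Measure.restrict_apply measurableSet_Iic, Set.inter_comm, ← Set.Ici_inter_Iic,
      Set.inter_assoc, Set.Iic_inter_Iic, Set.Ici_inter_Iic]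
    change ν {t | cdf ν t ≤ u} = _
    rcases lt_or_ge u 0 with h0 | h0
    · have he : {t | cdf ν t ≤ u} = ∅ :=
        Set.eq_empty_of_forall_notMem fun t ht => absurd (cdf_nonneg ν t) (not_le.2 (ht.trans_lt h0))
      simp [he, h0]
    · rcases lt_or_ge u 1 with h1 | h1
      · rw [measure_cdf_le hcont h0 h1]; simp [h1.le]
      · have he : {t | cdf ν t ≤ u} = Set.univ :=
          Set.eq_univ_of_forall fun t => (cdf_le_one ν t).trans h1
        simp [he, h1]

theorem probabilityContent_coe_coe {ν : Measure ℝ} [IsProbabilityMeasure ν]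
    (hcont : Continuous (cdf ν)) {a b : ℝ} (hab : a ≤ b) :
    probabilityContent ν a b = cdf ν b - cdf ν a := by
  have hset : {t : ℝ | (a : EReal) ≤ t ∧ (t : EReal) ≤ b} = Set.Icc a b := by
    ext t; simp
  have hν : ν (Set.Icc a b) = ENNReal.ofReal (cdf ν b - cdf ν a) := by
    conv_lhs => rw [← measure_cdf ν]
    rw [StieltjesFunction.measure_Icc, hcont.continuousAt.continuousWithinAt.leftLim_eq]
  rw [probabilityContent, hset, setIntegral_const, smul_eq_mul, mul_one, measureReal_def, hν,
    ENNReal.toReal_ofReal (sub_nonneg.2 (monotone_cdf ν hab))]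

theorem probabilityContent_bot_coe (ν : Measure ℝ) [IsProbabilityMeasure ν] (b : ℝ) :
    probabilityContent ν ⊥ b = cdf ν b := by
  have hset : {t : ℝ | ⊥ ≤ (t : EReal) ∧ (t : EReal) ≤ b} = Set.Iic b := by
    ext t; simp
  rw [probabilityContent, hset, setIntegral_const, smul_eq_mul, mul_one, cdf_eq_real]

/-- Even if `f` creates ties and the sorting permutations differ, the increasing rearrangement is
unique as a list of values. -/
theorem comp_apply_sort_comp {N : ℕ} {f : ℝ → ℝ} (hf : Monotone f) (v : Fin N → ℝ) (l : Fin N) :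
    f (v (Tuple.sort v l)) = (f ∘ v) (Tuple.sort (f ∘ v) l) :=
  congrFun (Tuple.unique_monotone (f := f ∘ v) (σ := Tuple.sort v)
    (hf.comp (Tuple.monotone_sort v)) (Tuple.monotone_sort (f ∘ v))) l

theorem probabilityContent_orderStatistic_eq {ν : Measure ℝ} [IsProbabilityMeasure ν]
    (hcont : Continuous (cdf ν)) {N : ℕ} (v : Fin N → ℝ) (k l : Fin N) (hkl : k ≤ l) :
    probabilityContent ν (orderStatistic v (k + 1)) (orderStatistic v (l + 1)) =
      (cdf ν ∘ v) (Tuple.sort (cdf ν ∘ v) l) - (cdf ν ∘ v) (Tuple.sort (cdf ν ∘ v) k) := by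
  have h (m : Fin N) : orderStatistic v (m + 1) = (v (Tuple.sort v m) : ℝ) := by
    simp [orderStatistic]
  have hle : v (Tuple.sort v k) ≤ v (Tuple.sort v l) := Tuple.monotone_sort v hkl
  rw [h, h, probabilityContent_coe_coe hcont hle,
    comp_apply_sort_comp (monotone_cdf ν), comp_apply_sort_comp (monotone_cdf ν)]

theorem probabilityContent_orderStatistic_zero_eq (ν : Measure ℝ) [IsProbabilityMeasure ν]
    {N : ℕ} (v : Fin N → ℝ) (l : Fin N) :
    probabilityContent ν (orderStatistic v 0) (orderStatistic v (l + 1)) =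
      (cdf ν ∘ v) (Tuple.sort (cdf ν ∘ v) l) := by
  have h : orderStatistic v (l + 1) = (v (Tuple.sort v l) : ℝ) := by simp [orderStatistic]
  have h0 : orderStatistic v 0 = ⊥ := by simp [orderStatistic]
  rw [h, h0, probabilityContent_bot_coe, comp_apply_sort_comp (monotone_cdf ν)]

theorem theorem2 {Ω : Type*} [MeasurableSpace Ω] (P : Measure Ω) [IsProbabilityMeasure P]
    (ν : Measure ℝ) [IsProbabilityMeasure ν] (hcont : Continuous (cdf ν))
    {N : ℕ} (y : Fin N → Ω → ℝ)
    (hlaw : ∀ i, HasLaw (y i) ν P) (hindep : iIndepFun y P)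
    (r s : ℕ) (hrs : r < s) (hsN : s ≤ N)
    (γ : ℝ) (hγ0 : 0 < γ) (hγ1 : γ < 1) :
    Measurable (fun x : Fin N → ℝ => orderStatistic x r) ∧
    Measurable (fun x : Fin N → ℝ => orderStatistic x s) ∧
    ∃ β : ℝ, 0 < β ∧ β < 1 ∧
      P.real {ω | γ < probabilityContent ν
          (orderStatistic (fun i => y i ω) r) (orderStatistic (fun i => y i ω) s)} = β ∧
      β = 1 - regularizedBeta γ (s - r) (N - s + r + 1) ∧
      β = ∑ j ∈ Finset.range (s - r), (N.choose j : ℝ) * γ ^ j * (1 - γ) ^ (N - j) := by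
  refine ⟨measurable_orderStatistic r, measurable_orderStatistic s, _,
    sum_choose_mul_pow_pos (m := s - r) (N := N) (by omega) hγ0 hγ1,
    sum_choose_mul_pow_lt_one (by omega) hγ0 hγ1, ?_, ?_, rfl⟩
  · have hU : HasLaw (fun ω => cdf ν ∘ fun i => y i ω)
        (Measure.pi fun _ : Fin N => volume.restrict (Set.Icc (0 : ℝ) 1)) P :=
      (hindep.comp (fun _ => cdf ν) fun _ => hcont.measurable).hasLaw_pi
        fun i => (hasLaw_cdf hcont).comp (hlaw i)
    -- `orderStatistic` counts ranks from 1, `Fin N` from 0; rank 0 is the infinite endpoint and is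
    -- treated separately.
    obtain ⟨l, rfl⟩ : ∃ l, s = l + 1 := ⟨s - 1, by omega⟩
    let l' : Fin N := ⟨l, hsN⟩
    rcases r with _ | k
    · have h := hU.measureReal_eq (p := fun v => γ < v (Tuple.sort v l'))
        (measurableSet_lt measurable_const (measurable_apply_sort l'))
      rw [pi_restrict_Icc_real_lt_sort l' hγ0 hγ1] at h
      rw [Nat.sub_zero, ← h]
      congr 1; ext ω
      exact iff_of_eq (congrArg (γ < ·) (probabilityContent_orderStatistic_zero_eq ν _ l'))
    · let k' : Fin N := ⟨k, by omega⟩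
      have hkl : k' < l' := Nat.lt_of_succ_lt_succ hrs
      have h := hU.measureReal_eq (p := fun v => γ < v (Tuple.sort v l') - v (Tuple.sort v k'))
        (measurableSet_lt measurable_const
          ((measurable_apply_sort l').sub (measurable_apply_sort k')))
      rw [pi_restrict_Icc_real_lt_sort_sub_sort k' l' hkl hγ0 hγ1] at h
      rw [Nat.add_sub_add_right, ← h]
      congr 1; ext ω
      exact iff_of_eq (congrArg (γ < ·)
        (probabilityContent_orderStatistic_eq hcont _ k' l' hkl.le))
  · have h := regularizedBeta_eq_one_sub_sum (m := s - r) (N := N) (by omega) (by omega) γ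
    rw [show N - (s - r) + 1 = N - s + r + 1 by omega] at h
    rw [h, sub_sub_cancel]
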